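/- Let $A=\{a,b,c\}$, $B=\{0,1\}$, $S=\{1,2,3\}$. A circular word $[u]$ is the class of a finite word $u$ under conjugacy ($xy\sim yx$). A factor of $[u]$ is a factor (contiguous subword) of some conjugate of $u$, and $[u]$ is square-free if no factor of it has the form $xx$ with $x$ non-empty. A circular word over $A$ is level if the numbers of occurrences of any two letters of $A$ in it differ by at most $1$. If $z=z_1z_2\cdots z_n$ is a word over $A$ with $n\ge 2$ such that $[z]$ has no factor $xx$ with $x\in A$, then the circular Pansiot encoding of $[z]$ is the circular word $[u_1u_2\cdots u_n]$ over $B$, where $u_i=0$ if $z_i=z_{i+2}$ and $u_i=1$ otherwise (indices modulo $n$); a binary word $u$ encodes $[z]$ if $[u]$ is the circular Pansiot encoding of $[z]$. A binary word encodes at most one circular word over $A$, up to permutation of the alphabet $A$. Let $f:S^*\to B^*$ and $h:A^*\to S^*$ be the morphisms with $$f(1)=01,\quad f(2)=011,\quad f(3)=0111,\qquad h(a)=123123,\quad h(b)=132132,\quad h(c)=131313.$$ **Corollary.** Let $[v]$ be a circular square-free word over $A$ such that $v$ has prefix $a$ and suffix $b$. Let $w=h(v)$, and let $s$ be one of the $54$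 words listed below. Then $f(ws)$ encodes a level circular square-free word over $A$ of length $|f(w)|+|f(s)|$. That is, $f(ws)$ encodes some circular word over $A$, and every circular word over $A$ that it encodes is level, square-free, and of length $|f(w)|+|f(s)|$. The words $s$ (with $|f(s)|=54,55,\dots,107$, in this order) are $$\begin{aligned} &331313123231212122, 331313232321212122, 331232323231212122,\\ &33131312121231212122, 331323232321313122, 33123232132121212122,\\ &33123123213231212122, 33131323231231212122, 33132323123231212122,\\ &33131323232312132122, 33132323231232132122, 33132323231313232122,\\ &3312321313123231212122, 3312323232313121212122, 3312323213232321212122,\\ &3312312323231232132122, 3312323232313132132122, 3312323232312132323122,\\ &331212323123213231212122, 331212323131323231212122, 331212323123213232312122,\\ &331212323232132321313122, 331212323213132323232122, 331212323232132323232122,\\ &331232313132323232313122, 331313232323123232323122, 33121212323232321323212122,\\ &33121212313132323232313122, 33121213232323231313232122, 33121213232323123232323122,\\ &33123123232321323232313122, 33123123232323213232323122, 3312121212323232312132323122,\\ &3312121232323232132321313122, 3312121232323213132323232122, 3312121232323232132323232122,\\ &3312123232313132323232313122, 3312132323232132323232313122, 3312323213232323123232323122,\\ &331212121232313132323232313122,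 331212121313232323123232323122, 331212123232323213232132323122,\\ &331212132323232313123232323122, 331212323123232323213232323122, 331231232323232132323232313122,\\ &33121212123123232321323232313122, 33121212123123232323213232323122, 33121212312323232321323232313122,\\ &33121212323232313132323232313122, 33121232312323232313132323232122, 33121232323213232323123232323122,\\ &33123232132323232313123232323122, 33123232323123232323213232323122, 3312121212323213232323123232323122. \end{aligned}$$ -/

import Mathlib

namespace LevelWords

/-! ## Alphabets -/

/-- The ternary alphabet `A = {a, b, c}`. -/
inductive A where
  | a | b | c
  deriving DecidableEq

/-- The alphabet `S = {1, 2, 3}`. -/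
inductive S where
  | one | two | three
  deriving DecidableEq

instance : OfNat S 1 := ⟨S.one⟩
instance : OfNat S 2 := ⟨S.two⟩
instance : OfNat S 3 := ⟨S.three⟩

/-- The binary alphabet `B = {0, 1}`. -/
abbrev B : Type := Fin 2

/-! ## Circular words

Words over `α` are lists, and circular words are elements of `Cycle α`, the quotient of `List α`
by conjugacy (rotation). -/

/-- `u` is a factor of the circular word `Z`: it is a factor of some representative of `Z`. -/
def IsCircularFactor {α : Type*} (u : List α) (Z : Cycle α) : Prop :=
  ∃ w : List α, (w : Cycle α) = Z ∧ u <:+: w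

/-- A circular word is square-free if none of its factors is a square `xx` with `x` non-empty. -/
def CircularSquareFree {α : Type*} (Z : Cycle α) : Prop :=
  ∀ x : List α, x ≠ [] → ¬ IsCircularFactor (x ++ x) Z

/-- A circular ternary word is level if the numbers of occurrences of any two letters of `A`
differ by at most one. -/
def IsLevel (Z : Cycle A) : Prop :=
  ∀ x y : A, Z.toMultiset.count y ≤ Z.toMultiset.count x + 1

/-! ## Circular Pansiot encodings -/

/-- The word `u₁ ⋯ uₙ` with `uᵢ = 0` if `zᵢ = zᵢ₊₂` and `uᵢ = 1` otherwise, for `z = z₁ ⋯ zₙ`,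
with indices taken modulo `n`. -/
def pansiotWord (z : List A) : List B :=
  List.ofFn fun i : Fin z.length =>
    if z.get i = z.get ⟨(i + 2) % z.length, Nat.mod_lt _ i.pos⟩ then 0 else 1

/-- `U` is the circular Pansiot encoding of the circular ternary word `Z`, which has length at
least two and has no square of length two as a factor. -/
def IsCircularPansiotEncoding (U : Cycle B) (Z : Cycle A) : Prop :=
  2 ≤ Z.length ∧ (∀ x : A, ¬ IsCircularFactor [x, x] Z) ∧
    ∃ z : List A, (z : Cycle A) = Z ∧ U = (pansiotWord z : Cycle B)

/-! ## The morphisms `f` and `h` -/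

/-- The images of the letters under `f`. -/
def fLetter : S → List B
  | S.one => [0, 1]
  | S.two => [0, 1, 1]
  | S.three => [0, 1, 1, 1]

/-- The morphism `f : S* → B*` with `f(n) = 01ⁿ`. -/
def f (u : List S) : List B := u.flatMap fLetter

/-- The images of the letters under `h`. -/
def hLetter : A → List S
  | A.a => [1, 2, 3, 1, 2, 3]
  | A.b => [1, 3, 2, 1, 3, 2]
  | A.c => [1, 3, 1, 3, 1, 3]

/-- The morphism `h : A* → S*`. -/
def h (v : List A) : List S := v.flatMap hLetter

/-- The table of linking words `s`, in order of increasing length `54, 55, …, 107` of `f s`. -/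
def linkingWords : List (List S) :=
  [[3,3,1,3,1,3,1,2,3,2,3,1,2,1,2,1,2,2],
   [3,3,1,3,1,3,2,3,2,3,2,1,2,1,2,1,2,2],
   [3,3,1,2,3,2,3,2,3,2,3,1,2,1,2,1,2,2],
   [3,3,1,3,1,3,1,2,1,2,1,2,3,1,2,1,2,1,2,2],
   [3,3,1,3,2,3,2,3,2,3,2,1,3,1,3,1,2,2],
   [3,3,1,2,3,2,3,2,1,3,2,1,2,1,2,1,2,1,2,2],
   [3,3,1,2,3,1,2,3,2,1,3,2,3,1,2,1,2,1,2,2],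
   [3,3,1,3,1,3,2,3,2,3,1,2,3,1,2,1,2,1,2,2],
   [3,3,1,3,2,3,2,3,1,2,3,2,3,1,2,1,2,1,2,2],
   [3,3,1,3,1,3,2,3,2,3,2,3,1,2,1,3,2,1,2,2],
   [3,3,1,3,2,3,2,3,2,3,1,2,3,2,1,3,2,1,2,2],
   [3,3,1,3,2,3,2,3,2,3,1,3,1,3,2,3,2,1,2,2],
   [3,3,1,2,3,2,1,3,1,3,1,2,3,2,3,1,2,1,2,1,2,2],
   [3,3,1,2,3,2,3,2,3,2,3,1,3,1,2,1,2,1,2,1,2,2],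
   [3,3,1,2,3,2,3,2,1,3,2,3,2,3,2,1,2,1,2,1,2,2],
   [3,3,1,2,3,1,2,3,2,3,2,3,1,2,3,2,1,3,2,1,2,2],
   [3,3,1,2,3,2,3,2,3,2,3,1,3,1,3,2,1,3,2,1,2,2],
   [3,3,1,2,3,2,3,2,3,2,3,1,2,1,3,2,3,2,3,1,2,2],
   [3,3,1,2,1,2,3,2,3,1,2,3,2,1,3,2,3,1,2,1,2,1,2,2],
   [3,3,1,2,1,2,3,2,3,1,3,1,3,2,3,2,3,1,2,1,2,1,2,2],
   [3,3,1,2,1,2,3,2,3,1,2,3,2,1,3,2,3,2,3,1,2,1,2,2],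
   [3,3,1,2,1,2,3,2,3,2,3,2,1,3,2,3,2,1,3,1,3,1,2,2],
   [3,3,1,2,1,2,3,2,3,2,1,3,1,3,2,3,2,3,2,3,2,1,2,2],
   [3,3,1,2,1,2,3,2,3,2,3,2,1,3,2,3,2,3,2,3,2,1,2,2],
   [3,3,1,2,3,2,3,1,3,1,3,2,3,2,3,2,3,2,3,1,3,1,2,2],
   [3,3,1,3,1,3,2,3,2,3,2,3,1,2,3,2,3,2,3,2,3,1,2,2],
   [3,3,1,2,1,2,1,2,3,2,3,2,3,2,3,2,1,3,2,3,2,1,2,1,2,2],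
   [3,3,1,2,1,2,1,2,3,1,3,1,3,2,3,2,3,2,3,2,3,1,3,1,2,2],
   [3,3,1,2,1,2,1,3,2,3,2,3,2,3,2,3,1,3,1,3,2,3,2,1,2,2],
   [3,3,1,2,1,2,1,3,2,3,2,3,2,3,1,2,3,2,3,2,3,2,3,1,2,2],
   [3,3,1,2,3,1,2,3,2,3,2,3,2,1,3,2,3,2,3,2,3,1,3,1,2,2],
   [3,3,1,2,3,1,2,3,2,3,2,3,2,3,2,1,3,2,3,2,3,2,3,1,2,2],
   [3,3,1,2,1,2,1,2,1,2,3,2,3,2,3,2,3,1,2,1,3,2,3,2,3,1,2,2],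
   [3,3,1,2,1,2,1,2,3,2,3,2,3,2,3,2,1,3,2,3,2,1,3,1,3,1,2,2],
   [3,3,1,2,1,2,1,2,3,2,3,2,3,2,1,3,1,3,2,3,2,3,2,3,2,1,2,2],
   [3,3,1,2,1,2,1,2,3,2,3,2,3,2,3,2,1,3,2,3,2,3,2,3,2,1,2,2],
   [3,3,1,2,1,2,3,2,3,2,3,1,3,1,3,2,3,2,3,2,3,2,3,1,3,1,2,2],
   [3,3,1,2,1,3,2,3,2,3,2,3,2,1,3,2,3,2,3,2,3,2,3,1,3,1,2,2],
   [3,3,1,2,3,2,3,2,1,3,2,3,2,3,2,3,1,2,3,2,3,2,3,2,3,1,2,2],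
   [3,3,1,2,1,2,1,2,1,2,3,2,3,1,3,1,3,2,3,2,3,2,3,2,3,1,3,1,2,2],
   [3,3,1,2,1,2,1,2,1,3,1,3,2,3,2,3,2,3,1,2,3,2,3,2,3,2,3,1,2,2],
   [3,3,1,2,1,2,1,2,3,2,3,2,3,2,3,2,1,3,2,3,2,1,3,2,3,2,3,1,2,2],
   [3,3,1,2,1,2,1,3,2,3,2,3,2,3,2,3,1,3,1,2,3,2,3,2,3,2,3,1,2,2],
   [3,3,1,2,1,2,3,2,3,1,2,3,2,3,2,3,2,3,2,1,3,2,3,2,3,2,3,1,2,2],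
   [3,3,1,2,3,1,2,3,2,3,2,3,2,3,2,1,3,2,3,2,3,2,3,2,3,1,3,1,2,2],
   [3,3,1,2,1,2,1,2,1,2,3,1,2,3,2,3,2,3,2,1,3,2,3,2,3,2,3,1,3,1,2,2],
   [3,3,1,2,1,2,1,2,1,2,3,1,2,3,2,3,2,3,2,3,2,1,3,2,3,2,3,2,3,1,2,2],
   [3,3,1,2,1,2,1,2,3,1,2,3,2,3,2,3,2,3,2,1,3,2,3,2,3,2,3,1,3,1,2,2],
   [3,3,1,2,1,2,1,2,3,2,3,2,3,2,3,1,3,1,3,2,3,2,3,2,3,2,3,1,3,1,2,2],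
   [3,3,1,2,1,2,3,2,3,1,2,3,2,3,2,3,2,3,1,3,1,3,2,3,2,3,2,3,2,1,2,2],
   [3,3,1,2,1,2,3,2,3,2,3,2,1,3,2,3,2,3,2,3,1,2,3,2,3,2,3,2,3,1,2,2],
   [3,3,1,2,3,2,3,2,1,3,2,3,2,3,2,3,2,3,1,3,1,2,3,2,3,2,3,2,3,1,2,2],
   [3,3,1,2,3,2,3,2,3,2,3,1,2,3,2,3,2,3,2,3,2,1,3,2,3,2,3,2,3,1,2,2],
   [3,3,1,2,1,2,1,2,1,2,3,2,3,2,1,3,2,3,2,3,2,3,1,2,3,2,3,2,3,2,3,1,2,2]]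

end LevelWords

/-!
Decode `f (h x)` from the initial letters `ab`: the result is a block `g x` of length `18` that
again leads to `ab`, so `f (h v ++ s)` encodes the circular word formed by the blocks `g x` for the
letters `x` of `v`, followed by the decoding `L` of `f s`. Two circular words with the same Pansiot
encoding differ by a permutation of the letters, so it is enough to treat this one.

In a word made of blocks, `aba` occurs only at the beginnings of blocks. Hence a long square has a
period divisible by `18` and descends to a square of letters in `v`, and there is none. Now consider
a square that reaches well into `L`. A factor that occurs only once in the circular word cannot lie
inside one half of a square, so if the square covers it, it contains the centre. Near its beginning
and near its end `L` has such a factor, and these two are too far apart to contain the centre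
together. A square which is not confined to a short neighbourhood of `L` therefore covers just one
of them. Then it repeats either the letters in front of `L` or those behind it inside `L`, which
does not happen.
-/

namespace LevelWords

instance : Inhabited A := ⟨A.a⟩
instance : Fintype A := ⟨{.a, .b, .c}, fun x => by cases x <;> decide⟩

/-! ### Factors and squares of two-sided infinite words -/

section TwoSided

variable {α : Type*} {t t' : ℤ → α} {i i' j : ℤ} {e n p : ℕ}

/-- The factor of length `e` at position `i` of the two-sided infinite word `t`. -/
def factor (t : ℤ → α) (i : ℤ) (e : ℕ) : List α := (List.range e).map fun k : ℕ => t (i + k)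

@[simp] theorem length_factor : (factor t i e).length = e := by simp [factor]

theorem factor_add (t : ℤ → α) (i : ℤ) (m n : ℕ) :
    factor t i (m + n) = factor t i m ++ factor t (i + m) n := by
  simp [factor, List.range_add, Function.comp_def, add_assoc]

theorem take_factor {m : ℕ} (h : m ≤ n) : (factor t i n).take m = factor t i m := by
  obtain ⟨k, rfl⟩ := Nat.exists_eq_add_of_le h
  rw [factor_add, List.take_left' length_factor]

theorem factor_eq_factor_iff :
    factor t i e = factor t' i' e ↔ ∀ x : ℤ, 0 ≤ x → x < e → t (i + x) = t' (i' + x) := by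
  simp only [factor, List.map_inj_left, List.mem_range]
  refine ⟨fun h x hx hxe => ?_, fun h k hk => h k (by omega) (by omega)⟩
  lift x to ℕ using hx
  exact h x (by omega)

theorem factor_eq_factor_of_subset (h : factor t i n = factor t' i' n) (hj : i ≤ j)
    (hjn : j + e ≤ i + n) : factor t j e = factor t' (j + (i' - i)) e := by
  rw [factor_eq_factor_iff] at h ⊢
  intro x hx hxe
  convert h (j - i + x) (by omega) (by omega) using 2 <;> ring

theorem factor_add_mul_of_periodic {N : ℤ} (h : Function.Periodic t N) (k : ℤ) :
    factor t (i + k * N) e = factor t i e :=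
  factor_eq_factor_iff.2 fun x _ _ => by
    rw [add_right_comm]
    exact h.int_mul k (i + x)

theorem isInfix_factor_iff {u : List α} :
    u <:+: factor t i n ↔ ∃ k : ℕ, k + u.length ≤ n ∧ factor t (i + k) u.length = u := by
  constructor
  · rintro ⟨x, y, h⟩
    have hn : n = x.length + u.length + y.length := by
      rw [← length_factor (t := t) (i := i) (e := n), ← h]; simp [add_assoc]
    subst hn
    rw [factor_add, factor_add] at h
    have hxu := List.append_inj_left h (by simp)
    exact ⟨x.length, by omega, (List.append_inj_right hxu (by simp)).symm⟩
  · rintro ⟨k, hk, h⟩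
    obtain ⟨m, rfl⟩ := Nat.exists_eq_add_of_le hk
    rw [factor_add, factor_add, h]
    exact ⟨_, _, rfl⟩

/-- The factor of length `2 * p` at position `i` of `t` is a square. -/
def IsSquareAt (t : ℤ → α) (i : ℤ) (p : ℕ) : Prop := factor t i p = factor t (i + p) p

namespace IsSquareAt

theorem apply_add (h : IsSquareAt t i p) {x : ℤ} (hx : i ≤ x) (hxp : x < i + p) :
    t (x + p) = t x := by
  have := factor_eq_factor_iff.1 h (x - i) (by omega) (by omega)
  rw [show x + p = i + p + (x - i) by ring, ← this, add_sub_cancel]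

theorem congr (h : IsSquareAt t i p) (heq : factor t i (p + p) = factor t' i' (p + p)) :
    IsSquareAt t' i' p := by
  rw [factor_add, factor_add] at heq
  have := List.append_inj heq (by simp)
  rw [IsSquareAt, ← this.1, ← this.2]
  exact h

theorem factor_add_period (h : IsSquareAt t i p) (hj : i ≤ j) (hje : j + e ≤ i + p) :
    factor t (j + p) e = factor t j e :=
  factor_eq_factor_iff.2 fun x _ _ => by
    rw [add_right_comm, h.apply_add (by omega) (by omega)]

theorem factor_sub_period (h : IsSquareAt t i p) (hj : i + p ≤ j) (hje : j + e ≤ i + p + p) :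
    factor t (j - p) e = factor t j e := by
  rw [← h.factor_add_period (j := j - p) (by omega) (by omega), sub_add_cancel]

/-- A factor without a second occurrence at distance `p` cannot lie in either half of a square. -/
theorem center_mem_Ioo {N : ℤ} (h : IsSquareAt t i p) (hp : 0 < p) (hpN : p < N)
    (hunique : ∀ x, factor t x e = factor t j e → N ∣ x - j)
    (hj : i ≤ j) (hje : j + e ≤ i + p + p) : i + p ∈ Set.Ioo j (j + e) := by
  have not_dvd : ¬ N ∣ (p : ℤ) := fun hd => by linarith [Int.le_of_dvd (by omega) hd]
  by_contra hcenter
  rcases le_or_gt (i + p) j with hle | hlt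
  · have := hunique _ (h.factor_sub_period hle hje)
    rw [sub_sub_cancel_left, dvd_neg] at this
    exact not_dvd this
  · have hje' : j + e ≤ i + p := not_lt.1 fun hlt' => hcenter ⟨hlt, hlt'⟩
    exact not_dvd (by simpa using hunique _ (h.factor_add_period hj hje'))

end IsSquareAt

theorem append_self_isInfix_factor_iff :
    (∃ x : List α, x.length = p ∧ x ++ x <:+: factor t i n) ↔
      ∃ k : ℕ, k + (p + p) ≤ n ∧ IsSquareAt t (i + k) p := by
  constructor
  · rintro ⟨x, rfl, hx⟩
    obtain ⟨k, hk, h⟩ := isInfix_factor_iff.1 hx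
    rw [List.length_append] at hk h
    rw [factor_add] at h
    have := List.append_inj h (by simp)
    exact ⟨k, hk, this.1.trans this.2.symm⟩
  · rintro ⟨k, hk, h⟩
    refine ⟨factor t (i + k) p, length_factor, isInfix_factor_iff.2 ⟨k, by simpa using hk, ?_⟩⟩
    rw [List.length_append, length_factor, factor_add, ← h]

end TwoSided

section PeriodicExtension

variable {α : Type*} [Inhabited α] {l : List α}

/-- The two-sided infinite word with period `l`, whose letters at `0, 1, …` are those of `l`. -/
def periodicExtension (l : List α) (x : ℤ) : α := l.getD (x % l.length).toNat default

theorem periodic_periodicExtension (l : List α) :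
    Function.Periodic (periodicExtension l) l.length := fun x => by
  simp [periodicExtension]

theorem periodicExtension_natCast {k : ℕ} (h : 0 < l.length) :
    periodicExtension l k = l[k % l.length]'(Nat.mod_lt k h) := by
  have hmod : ((k : ℤ) % l.length).toNat = k % l.length := Int.toNat_natCast _
  rw [periodicExtension, hmod, List.getD_eq_getElem]

theorem factor_periodicExtension_natCast (l : List α) (k : ℕ) :
    factor (periodicExtension l) k l.length = l.rotate k := by
  refine List.ext_getElem (by simp) fun j hj _ => ?_
  rw [length_factor] at hj
  have hletter := periodicExtension_natCast (k := j + k) (j.zero_le.trans_lt hj)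
  rw [Nat.cast_add, add_comm] at hletter
  simpa [factor, List.getElem_rotate] using hletter

theorem factor_periodicExtension_zero (l : List α) :
    factor (periodicExtension l) 0 l.length = l := by
  simpa using factor_periodicExtension_natCast l 0

theorem exists_eq_natCast_add_mul {N : ℕ} (hN : 0 < N) (x : ℤ) :
    ∃ (k : ℕ) (q : ℤ), k < N ∧ x = k + q * N := by
  have hnonneg : 0 ≤ x % N := Int.emod_nonneg x (by omega)
  have hlt : x % N < N := Int.emod_lt_of_pos x (by omega)
  exact ⟨(x % N).toNat, x / N, by omega,
    by rw [Int.toNat_of_nonneg hnonneg, mul_comm, Int.emod_add_mul_ediv]⟩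

theorem eq_periodicExtension_of_periodic {t : ℤ → α} (ht : Function.Periodic t l.length)
    (hl : 0 < l.length) (h : factor t 0 l.length = l) : t = periodicExtension l := by
  funext x
  obtain ⟨k, q, hk, rfl⟩ := exists_eq_natCast_add_mul hl x
  rw [← zero_add (k : ℤ)]
  have hfactor := factor_eq_factor_iff.1 (h.trans (factor_periodicExtension_zero l).symm) k
    (by omega) (by omega)
  exact ((ht.int_mul q) _).trans (hfactor.trans ((periodic_periodicExtension l).int_mul q _).symm)

theorem periodicExtension_rotate (l : List α) (k : ℕ) :
    periodicExtension (l.rotate k) = fun x => periodicExtension l (x + k) := by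
  rcases l.length.eq_zero_or_pos with hnil | hpos
  · rw [List.length_eq_zero_iff.1 hnil]
    rfl
  refine (eq_periodicExtension_of_periodic (fun x => ?_) (by simpa using hpos) ?_).symm
  · rw [List.length_rotate, add_right_comm, periodic_periodicExtension]
  · rw [List.length_rotate, ← factor_periodicExtension_natCast]
    simp [factor, add_comm]

theorem isCircularFactor_coe_iff {u : List α} :
    IsCircularFactor u (l : Cycle α) ↔
      u.length ≤ l.length ∧ ∃ i, factor (periodicExtension l) i u.length = u := by
  constructor
  · rintro ⟨w, hw, hu⟩
    obtain ⟨k, rfl⟩ := (Cycle.coe_eq_coe.1 hw).symm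
    rw [← factor_periodicExtension_natCast] at hu
    obtain ⟨m, hm, h⟩ := isInfix_factor_iff.1 hu
    exact ⟨by omega, _, h⟩
  · rintro ⟨hu, i, h⟩
    rcases u.length.eq_zero_or_pos with hnil | hpos
    · rw [List.length_eq_zero_iff.1 hnil]
      exact ⟨l, rfl, List.nil_infix⟩
    obtain ⟨k, q, -, rfl⟩ := exists_eq_natCast_add_mul (hpos.trans_le hu) i
    rw [factor_add_mul_of_periodic (periodic_periodicExtension l)] at h
    refine ⟨l.rotate k, Cycle.coe_eq_coe.2 (List.IsRotated.symm ⟨k, rfl⟩), ?_⟩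
    rw [← factor_periodicExtension_natCast]
    exact isInfix_factor_iff.2 ⟨0, by simpa using hu, by simpa using h⟩

theorem circularSquareFree_coe_iff :
    CircularSquareFree (l : Cycle α) ↔
      ∀ i p, 0 < p → p + p ≤ l.length → ¬ IsSquareAt (periodicExtension l) i p := by
  constructor
  · intro h i p hp hpl hsq
    refine h (factor (periodicExtension l) i p) ?_ ?_
    · exact List.ne_nil_of_length_pos (by simpa using hp)
    · refine isCircularFactor_coe_iff.2 ⟨by simpa using hpl, i, ?_⟩
      rw [List.length_append, length_factor, factor_add, ← hsq]
  · intro h x hx hfac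
    obtain ⟨hl, i, hi⟩ := isCircularFactor_coe_iff.1 hfac
    rw [List.length_append] at hl hi
    rw [factor_add] at hi
    have := List.append_inj hi (by simp)
    exact h i x.length (List.length_pos_of_ne_nil hx) hl (this.1.trans this.2.symm)

end PeriodicExtension

/-! ### Square-free words and occurrences -/

section SquareFree

variable {α : Type*} {t : ℤ → α} {b i : ℤ} {n p : ℕ} {E : List α}

/-- A word is square-free if none of its factors is a square `xx` with `x` non-empty. -/
def SquareFree (l : List α) : Prop := ∀ x : List α, x ≠ [] → ¬ x ++ x <:+: l

theorem squareFree_factor_iff :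
    SquareFree (factor t b n) ↔
      ∀ k p : ℕ, 0 < p → k + (p + p) ≤ n → ¬ IsSquareAt t (b + k) p := by
  constructor
  · intro h k p hp hk hsq
    obtain ⟨x, rfl, hx⟩ := append_self_isInfix_factor_iff.2 ⟨k, hk, hsq⟩
    exact h x (List.ne_nil_of_length_pos hp) hx
  · intro h x hx hfac
    obtain ⟨k, hk, hsq⟩ := append_self_isInfix_factor_iff.1 ⟨x, rfl, hfac⟩
    exact h k x.length (List.length_pos_of_ne_nil hx) hk hsq

theorem SquareFree.not_isSquareAt (h : SquareFree (factor t b n)) (hp : 0 < p) (hi : b ≤ i)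
    (hin : i + p + p ≤ b + n) : ¬ IsSquareAt t i p := by
  have := squareFree_factor_iff.1 h (i - b).toNat p hp (by omega)
  rwa [Int.toNat_of_nonneg (by omega), add_sub_cancel] at this

/-- The positions at which the word `E` occurs in `l`. -/
def occurrences [DecidableEq α] (E l : List α) : List ℕ := l.tails.findIdxs (E <+: ·)

theorem mem_occurrences_factor_iff [DecidableEq α] {k : ℕ} :
    k ∈ occurrences E (factor t b n) ↔ k + E.length ≤ n ∧ factor t (b + k) E.length = E := by
  simp only [occurrences, List.mem_findIdxs_iff_exists_getElem_pos, List.length_tails,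
    List.getElem_tails, length_factor, decide_eq_true_eq, exists_prop]
  refine ⟨fun ⟨hk, hE⟩ => ?_, fun ⟨hk, hE⟩ => ⟨by omega, ?_⟩⟩
  · have hlen : E.length ≤ n - k := by simpa using hE.length_le
    obtain ⟨m, rfl⟩ := Nat.exists_eq_add_of_le (show k + E.length ≤ n by omega)
    rw [add_assoc, factor_add, List.drop_left' length_factor, factor_add] at hE
    have := List.prefix_of_prefix_length_le hE (List.prefix_append _ _) (by simp)
    exact ⟨by omega, (this.eq_of_length (by simp)).symm⟩
  · obtain ⟨m, rfl⟩ := Nat.exists_eq_add_of_le hk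
    rw [add_assoc, factor_add, List.drop_left' length_factor, factor_add, hE]
    exact List.prefix_append _ _

end SquareFree

section Bitsets

variable {t : ℤ → A} {n p : ℕ}

/-- The set of positions of the letter `x` in a word, as the number with these bits. Arithmetic on
such numbers makes square-freeness of a word over `A` quick to decide. -/
def positions (x : A) : List A → ℕ
  | [] => 0
  | y :: l => Nat.bit (y == x) (positions x l)

theorem testBit_positions {x : A} {l : List A} {k : ℕ} :
    (positions x l).testBit k ↔ l[k]? = some x := by
  induction l generalizing k with
  | nil => simp [positions]
  | cons y l ih => cases k <;> simp [positions, Nat.testBit_bit_succ, ih]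

/-- The set of positions `k` with `l[k] = l[k + p]`, as the number with these bits. -/
def coincidences (l : List A) (p : ℕ) : ℕ :=
  (positions .a l &&& positions .a l >>> p) ||| (positions .b l &&& positions .b l >>> p) |||
    (positions .c l &&& positions .c l >>> p)

theorem testBit_coincidences_factor {k : ℕ} :
    (coincidences (factor t 0 n) p).testBit k ↔ k + p < n ∧ t (k + p) = t k := by
  have getElem?_iff (k : ℕ) (x : A) : (factor t 0 n)[k]? = some x ↔ k < n ∧ t k = x := by
    simp [factor, List.getElem?_eq_some_iff]
  simp only [coincidences, Nat.testBit_or, Nat.testBit_and, Nat.testBit_shiftRight,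
    Bool.or_eq_true, Bool.and_eq_true, testBit_positions, getElem?_iff, add_comm p k, Nat.cast_add]
  cases t (k + p) <;> cases t k <;> simp <;> omega

theorem testBit_iterate_and_shiftRight {m d k : ℕ} :
    ((fun m : ℕ => m &&& m >>> 1)^[d] m).testBit k ↔ ∀ j ≤ d, m.testBit (k + j) := by
  induction d generalizing m k with
  | zero => simp
  | succ d ih =>
    rw [Function.iterate_succ_apply, ih]
    simp only [Nat.testBit_and, Nat.testBit_shiftRight, Bool.and_eq_true]
    refine ⟨fun h j hj => ?_, fun h j hj => ⟨h j (by omega), ?_⟩⟩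
    · rcases Nat.le_succ_iff.1 hj with hjd | rfl
      · exact (h j hjd).1
      · rw [Nat.succ_eq_one_add, add_left_comm]
        exact (h d le_rfl).2
    · rw [add_left_comm, add_comm 1 j]
      exact h (j + 1) (by omega)

theorem testBit_iterate_coincidences_factor {d k : ℕ} :
    ((fun m : ℕ => m &&& m >>> 1)^[d] (coincidences (factor t 0 n) (d + 1))).testBit k ↔
      k + (d + 1 + (d + 1)) ≤ n ∧ IsSquareAt t k (d + 1) := by
  simp only [testBit_iterate_and_shiftRight, testBit_coincidences_factor]
  constructor
  · intro h
    have := (h d le_rfl).1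
    refine ⟨by omega, factor_eq_factor_iff.2 fun x hx hxd => ?_⟩
    lift x to ℕ using hx
    have := (h x (by omega)).2
    rw [add_right_comm, ← Nat.cast_add, this]
  · rintro ⟨hk, hsq⟩ j hj
    refine ⟨by omega, ?_⟩
    rw [Nat.cast_add k j]
    exact hsq.apply_add (by omega) (by omega)

theorem squareFree_iff_iterate_coincidences_eq_zero {l : List A} :
    SquareFree l ↔ ∀ d < l.length / 2,
      (fun m : ℕ => m &&& m >>> 1)^[d] (coincidences l (d + 1)) = 0 := by
  obtain ⟨t, ht⟩ : ∃ t : ℤ → A, factor t 0 l.length = l := ⟨_, factor_periodicExtension_zero l⟩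
  rw [← ht, squareFree_factor_iff, length_factor]
  simp only [zero_add]
  constructor
  · intro h d _
    refine Nat.zero_of_testBit_eq_false fun k => ?_
    rw [← Bool.not_eq_true, testBit_iterate_coincidences_factor]
    exact fun ⟨hk, hsq⟩ => h k (d + 1) d.succ_pos hk hsq
  · intro h k p hp hk hsq
    obtain ⟨d, rfl⟩ := Nat.exists_eq_add_one_of_ne_zero hp.ne'
    have := testBit_iterate_coincidences_factor.2 ⟨hk, hsq⟩
    rw [h d (by omega), Nat.zero_testBit] at this
    exact Bool.false_ne_true this

instance (l : List A) : Decidable (SquareFree l) :=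
  decidable_of_iff' _ squareFree_iff_iterate_coincidences_eq_zero

end Bitsets

/-! ### Words in the blocks `g x` -/

/-- The decoding of `f (h x)` that starts with `ab`. -/
def g : A → List A
  | A.a => [.a, .b, .a, .c, .a, .b, .c, .b, .a, .c, .b, .c, .a, .c, .b, .a, .b, .c]
  | A.b => [.a, .b, .a, .c, .a, .b, .c, .a, .c, .b, .a, .b, .c, .b, .a, .c, .b, .c]
  | A.c => [.a, .b, .a, .c, .a, .b, .c, .a, .c, .b, .c, .a, .b, .c, .b, .a, .b, .c]

@[simp] theorem length_g (x : A) : (g x).length = 18 := by cases x <;> rfl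

theorem squareFree_g_append_append : ∀ x y z : A, x ≠ y → y ≠ z →
    SquareFree (g x ++ g y ++ g z) := by
  decide +kernel

theorem occurrences_aba_g_append : ∀ x y : A, x ≠ y →
    occurrences [.a, .b, .a] (g x ++ g y) = [0, 18] := by
  decide +kernel

/-- The two-sided infinite word whose factor of length `18` at `18 * m` is `g (V m)`. -/
def blockWord (V : ℤ → A) (x : ℤ) : A := (g (V (x / 18))).getD (x % 18).toNat default

section BlockWord

variable {V : ℤ → A} {x m : ℤ} {p : ℕ}

theorem blockWord_mul_add (V : ℤ → A) (m : ℤ) {k : ℕ} (hk : k < 18) :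
    blockWord V (18 * m + k) = (g (V m)).getD k default := by
  have hdiv : (18 * m + k) / 18 = m := by omega
  have hmod : (18 * m + k) % 18 = k := by omega
  rw [blockWord, hdiv, hmod, Int.toNat_natCast]

theorem factor_blockWord_mul_eighteen (V : ℤ → A) (m : ℤ) :
    factor (blockWord V) (18 * m) 18 = g (V m) := by
  refine List.ext_getElem (by simp) fun k hk hk' => ?_
  rw [length_factor] at hk
  simp [factor, blockWord_mul_add V m hk, hk]

theorem factor_blockWord_mul (V : ℤ → A) (m : ℤ) (k : ℕ) :
    factor (blockWord V) (18 * m) (18 * k) = (factor V m k).flatMap g := by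
  induction k with
  | zero => rfl
  | succ k ih =>
    rw [mul_add_one, factor_add, ih, factor_add, List.flatMap_append, Nat.cast_mul,
      Nat.cast_ofNat, ← mul_add, factor_blockWord_mul_eighteen]
    simp [factor]

theorem factor_blockWord_mul_thirtySix (V : ℤ → A) (m : ℤ) :
    factor (blockWord V) (18 * m) 36 = g (V m) ++ g (V (m + 1)) := by
  simpa [factor, List.range_succ] using factor_blockWord_mul V m 2

theorem dvd_of_factor_blockWord_eq_aba (hV : ∀ m, V m ≠ V (m + 1))
    (h : factor (blockWord V) x 3 = [.a, .b, .a]) : 18 ∣ x := by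
  have hx : 18 * (x / 18) + (x % 18).toNat = x := by omega
  have : (x % 18).toNat ∈ occurrences [.a, .b, .a] (factor (blockWord V) (18 * (x / 18)) 36) :=
    mem_occurrences_factor_iff.2 ⟨by simp; omega, by rw [hx]; exact h⟩
  rw [factor_blockWord_mul_thirtySix, occurrences_aba_g_append _ _ (hV _)] at this
  simp only [List.mem_cons, List.not_mem_nil, or_false] at this
  omega

theorem factor_blockWord_mul_five (V : ℤ → A) (m : ℤ) :
    factor (blockWord V) (18 * m) 5 = [.a, .b, .a, .c, .a] := by
  rw [← take_factor (n := 18) (by norm_num), factor_blockWord_mul_eighteen]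
  cases V m <;> rfl

theorem factor_blockWord_ne_abacb (hV : ∀ m, V m ≠ V (m + 1)) :
    factor (blockWord V) x 5 ≠ [.a, .b, .a, .c, .b] := by
  intro h
  have haba : factor (blockWord V) x 3 = [.a, .b, .a] := by
    rw [← take_factor (n := 5) (by norm_num), h]; rfl
  obtain ⟨m, rfl⟩ := dvd_of_factor_blockWord_eq_aba hV haba
  rw [factor_blockWord_mul_five] at h
  simp at h

theorem not_isSquareAt_blockWord_of_le (hV : ∀ m, V m ≠ V (m + 1)) (hp : 0 < p) (hp' : p ≤ 18) :
    ¬ IsSquareAt (blockWord V) x p := by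
  have hblocks := factor_blockWord_mul V (x / 18) 3
  have : SquareFree (factor (blockWord V) (18 * (x / 18)) 54) := by
    rw [hblocks, show (factor V (x / 18) 3).flatMap g =
      g (V (x / 18)) ++ g (V (x / 18 + 1)) ++ g (V (x / 18 + 1 + 1)) by
        simp [factor, List.range_succ, add_assoc]]
    exact squareFree_g_append_append _ _ _ (hV _) (hV _)
  exact this.not_isSquareAt hp (by omega) (by omega)

theorem dvd_of_isSquareAt_blockWord (hV : ∀ m, V m ≠ V (m + 1)) (hp : 18 < p)
    (h : IsSquareAt (blockWord V) x p) : 18 ∣ p := by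
  obtain ⟨m, hm, hm'⟩ : ∃ m, x ≤ 18 * m ∧ 18 * m < x + 18 := ⟨(x + 17) / 18, by omega, by omega⟩
  have haba (m : ℤ) : factor (blockWord V) (18 * m) 3 = [.a, .b, .a] := by
    rw [← take_factor (n := 5) (by norm_num), factor_blockWord_mul_five]; rfl
  rcases le_or_gt (18 * m + 3) (x + p) with hfirst | hfirst
  · have := dvd_of_factor_blockWord_eq_aba hV
      ((h.factor_add_period hm (by exact_mod_cast hfirst)).trans (haba m))
    omega
  · have := dvd_of_factor_blockWord_eq_aba hV
      ((h.factor_sub_period (j := 18 * (m + 1)) (e := 3) (by omega)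
        (by push_cast; omega)).trans (haba (m + 1)))
    omega

theorem exists_isSquareAt_of_blockWord (hV : ∀ m, V m ≠ V (m + 1)) (hp : 0 < p)
    (h : IsSquareAt (blockWord V) x p) : ∃ m q, 0 < q ∧ p = 18 * q ∧ IsSquareAt V m q := by
  have hlt : 18 < p := not_le.1 fun hle => not_isSquareAt_blockWord_of_le hV hp hle h
  obtain ⟨q, rfl⟩ := dvd_of_isSquareAt_blockWord hV hlt h
  have getD_injective : Function.Injective fun y => (g y).getD 11 default := by decide
  refine ⟨(x + 6) / 18, q, by omega, rfl, factor_eq_factor_iff.2 fun y hy hyq => ?_⟩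
  refine getD_injective ?_
  have := h.apply_add (x := 18 * ((x + 6) / 18 + y) + (11 : ℕ)) (by omega) (by omega)
  rw [blockWord_mul_add _ _ (by norm_num),
    show 18 * ((x + 6) / 18 + y) + (11 : ℕ) + (18 * q : ℕ) =
      18 * ((x + 6) / 18 + q + y) + (11 : ℕ) by push_cast; ring,
    blockWord_mul_add _ _ (by norm_num)] at this
  exact this.symm

end BlockWord

/-! ### Linked words -/

/-- The end of the word in front of a link: all of `g b` and the five letters that end both `g a`
and `g c`. -/
def leftContext : List A := (g A.c ++ g A.b).drop 13

/-- The start of the word behind a link: all of `g a` and the ten letters that start both `g b` and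
`g c`. -/
def rightContext : List A := (g A.a ++ g A.b).take 28

/-- The word `L`, used as a link, with the letters around it. -/
def window (L : List A) : List A := leftContext ++ L ++ rightContext

/-- The word that starts every link. -/
def leftMarker : List A := [.a, .b, .a, .c, .b, .a, .b, .c, .a, .b]

/-- The word at the end of every link; its last three letters belong to the block that follows. -/
def rightMarker : List A := [.a, .b, .a, .c, .b, .c, .a, .b, .a]

/-- The word `L` can be inserted between `g b` and `g a` without creating squares: its surroundings
are square-free, each marker occurs there exactly once, and the contexts behind the markers do not
recur inside `L`. -/
structure IsLink (L : List A) : Prop where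
  le_length : 15 ≤ L.length
  squareFree_window : SquareFree (window L)
  occurrences_leftMarker : occurrences leftMarker (window L) = [23]
  occurrences_rightMarker : occurrences rightMarker (window L) = [L.length + 17]
  not_leftContext_isInfix : ¬ leftContext <:+: L ++ [.a, .b]
  not_rightContext_isInfix : ¬ rightContext.drop 3 <:+: L ++ [.a, .b]

theorem factor_blockWord_eq_leftContext {V : ℤ → A} {m : ℤ} (hb : V (m + 1) = .b) (hm : V m ≠ .b) :
    factor (blockWord V) (18 * m + 13) 23 = leftContext := by
  have h := congrArg (List.drop 13) (factor_blockWord_mul_thirtySix V m)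
  rw [show 36 = 13 + 23 from rfl, factor_add, List.drop_left' length_factor, hb] at h
  refine h.trans ?_
  cases hx : V m <;> first | rfl | contradiction

theorem factor_blockWord_eq_rightContext {V : ℤ → A} {m : ℤ} (ha : V m = .a) (hm : V (m + 1) ≠ .a) :
    factor (blockWord V) (18 * m) 28 = rightContext := by
  rw [← take_factor (n := 36) (by norm_num), factor_blockWord_mul_thirtySix, ha]
  cases hx : V (m + 1) <;> first | rfl | contradiction

/-- The word `t` has period `18 * n + L.length`, within which the blocks `g (V m)` with `0 ≤ m < n`
are followed by the link `L`; the first of these blocks is `g a` and the last one is `g b`. -/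
structure IsLinkedWord (t V : ℤ → A) (n : ℕ) (L : List A) : Prop where
  isLink : IsLink L
  two_le : 2 ≤ n
  letter_ne : ∀ m, V m ≠ V (m + 1)
  letter_zero : V 0 = .a
  letter_neg_one : V (-1) = .b
  periodic_letters : Function.Periodic V n
  periodic : Function.Periodic t (18 * n + L.length : ℤ)
  factor_blocks : factor t 0 (18 * n) = factor (blockWord V) 0 (18 * n)
  factor_link : factor t (18 * n) L.length = L

namespace IsLinkedWord

variable {t V : ℤ → A} {n p : ℕ} {L E : List A} {i x : ℤ}

theorem factor_leftContext (ht : IsLinkedWord t V n L) :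
    factor t (18 * n - 23) 23 = leftContext := by
  have hn := ht.two_le
  have hlast : V (n - 2 + 1) = .b := by
    rw [← ht.letter_neg_one, ← ht.periodic_letters (-1)]; ring_nf
  rw [factor_eq_factor_of_subset ht.factor_blocks (by omega) (by push_cast; omega),
    ← factor_blockWord_eq_leftContext hlast fun h => ht.letter_ne (n - 2) (h.trans hlast.symm)]
  ring_nf

theorem factor_rightContext (ht : IsLinkedWord t V n L) :
    factor t (18 * n + L.length) 28 = rightContext := by
  have hn := ht.two_le
  have hperiod := factor_add_mul_of_periodic (i := 0) (e := 28) ht.periodic 1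
  rw [zero_add, one_mul] at hperiod
  rw [hperiod, factor_eq_factor_of_subset ht.factor_blocks (by omega) (by push_cast; omega)]
  exact factor_blockWord_eq_rightContext (m := 0) ht.letter_zero
    fun h => ht.letter_ne 0 (ht.letter_zero.trans h.symm)

theorem factor_window (ht : IsLinkedWord t V n L) :
    factor t (18 * n - 23) (L.length + 51) = window L := by
  rw [show L.length + 51 = 23 + L.length + 28 by ring, factor_add, factor_add,
    ht.factor_leftContext, window, ← ht.factor_rightContext]
  push_cast
  rw [sub_add_cancel, ht.factor_link, ← add_assoc, sub_add_cancel]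

theorem factor_link_append (ht : IsLinkedWord t V n L) :
    factor t (18 * n) (L.length + 2) = L ++ [.a, .b] := by
  rw [factor_add, ht.factor_link, ← take_factor (n := 28) (by norm_num), ht.factor_rightContext]
  rfl

theorem factor_rightContext_drop (ht : IsLinkedWord t V n L) :
    factor t (18 * n + L.length + 3) 25 = rightContext.drop 3 := by
  rw [← ht.factor_rightContext, show 28 = 3 + 25 from rfl, factor_add,
    List.drop_left' length_factor]
  rfl

theorem factor_eq_of_occurrences_eq (ht : IsLinkedWord t V n L) {k : ℕ}
    (hocc : occurrences E (window L) = [k]) : factor t (18 * n - 23 + k) E.length = E := by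
  have : k ∈ occurrences E (window L) := by simp [hocc]
  rw [← ht.factor_window, mem_occurrences_factor_iff] at this
  exact this.2

theorem factor_neg_five_five (ht : IsLinkedWord t V n L) :
    factor t (-5) 5 = factor (blockWord V) (-5) 5 := by
  have hmarker := ht.factor_eq_of_occurrences_eq ht.isLink.occurrences_rightMarker
  have hend := congrArg (fun l => (l.drop 1).take 5) hmarker
  rw [show rightMarker.length = 1 + (5 + 3) from rfl] at hend
  simp only [factor_add, List.drop_left' length_factor, List.take_left' length_factor] at hend
  have hperiod := factor_add_mul_of_periodic (i := -5) (e := 5) ht.periodic 1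
  have hblock := congrArg (List.drop 13) (factor_blockWord_mul_eighteen V (-1))
  rw [show 18 = 13 + 5 from rfl, factor_add, List.drop_left' length_factor,
    ht.letter_neg_one] at hblock
  calc
    factor t (-5) 5 = factor t (18 * n - 23 + (L.length + 17 : ℕ) + (1 : ℕ)) 5 := by
      rw [← hperiod]; push_cast; ring_nf
    _ = [.b, .a, .c, .b, .c] := hend
    _ = factor (blockWord V) (-5) 5 := hblock.symm

theorem factor_link_four (ht : IsLinkedWord t V n L) :
    factor t (18 * n) 4 = factor (blockWord V) (18 * n) 4 := by
  have hmarker := ht.factor_eq_of_occurrences_eq ht.isLink.occurrences_leftMarker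
  rw [Nat.cast_ofNat, sub_add_cancel] at hmarker
  rw [← take_factor (n := leftMarker.length) (by decide), hmarker,
    ← take_factor (n := 5) (by norm_num), factor_blockWord_mul_five]
  rfl

/-- Every link begins with the first four letters of all blocks and ends with the last five letters
of `g b`, so the agreement with `blockWord V` extends beyond the blocks. -/
theorem factor_blocks_extended (ht : IsLinkedWord t V n L) :
    factor t (-5) (18 * n + 9) = factor (blockWord V) (-5) (18 * n + 9) := by
  have hsplit (t : ℤ → A) : factor t (-5) (18 * n + 9) =
      factor t (-5) 5 ++ factor t 0 (18 * n) ++ factor t (18 * n) 4 := by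
    rw [show 18 * n + 9 = 5 + 18 * n + 4 by ring, factor_add, factor_add]
    push_cast
    ring_nf
  rw [hsplit, hsplit, ht.factor_neg_five_five, ht.factor_blocks, ht.factor_link_four]

theorem exists_eq_add_mul_period (ht : IsLinkedWord t V n L) (x : ℤ) :
    ∃ y k, x = y + k * (18 * n + L.length : ℤ) ∧ -5 ≤ y ∧ y < 18 * n + L.length - 5 := by
  have hpos : (0 : ℤ) < 18 * n + L.length := by have := ht.isLink.le_length; omega
  refine ⟨(x + 5) % (18 * n + L.length) - 5, (x + 5) / (18 * n + L.length), ?_, ?_, ?_⟩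
  · linarith [Int.emod_add_mul_ediv (x + 5) (18 * n + L.length)]
  · linarith [Int.emod_nonneg (x + 5) hpos.ne']
  · linarith [Int.emod_lt_of_pos (x + 5) hpos]

theorem factor_ne_abacb (ht : IsLinkedWord t V n L) (hx : -5 ≤ x) (hxn : x < 18 * n) :
    factor t x 5 ≠ [.a, .b, .a, .c, .b] := by
  rw [factor_eq_factor_of_subset ht.factor_blocks_extended hx (by push_cast; omega)]
  exact factor_blockWord_ne_abacb ht.letter_ne

theorem dvd_sub_of_factor_eq (ht : IsLinkedWord t V n L) {k : ℕ}
    (hocc : occurrences E (window L) = [k]) (hE : [.a, .b, .a, .c, .b] <+: E)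
    (hlen : E.length ≤ 33) (hx : factor t x E.length = E) :
    (18 * n + L.length : ℤ) ∣ x - (18 * n - 23 + k) := by
  obtain ⟨y, q, rfl, hy, hyN⟩ := ht.exists_eq_add_mul_period x
  rw [factor_add_mul_of_periodic ht.periodic] at hx
  have hyn : 18 * n ≤ y := by
    by_contra! hlt
    have habacb := List.prefix_iff_eq_take.1 hE
    rw [← hx, take_factor (by simpa using hE.length_le)] at habacb
    exact ht.factor_ne_abacb hy hlt habacb.symm
  have : (y - (18 * n - 23)).toNat ∈ occurrences E (window L) := by
    rw [← ht.factor_window, mem_occurrences_factor_iff, Int.toNat_of_nonneg (by omega),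
      add_sub_cancel]
    exact ⟨by omega, hx⟩
  rw [hocc, List.mem_singleton] at this
  exact ⟨q, by linarith [show y = 18 * n - 23 + k by omega]⟩

theorem center_mem_Ioo_of_occurrences_eq (ht : IsLinkedWord t V n L) {k : ℕ}
    (hocc : occurrences E (window L) = [k]) (hE : [.a, .b, .a, .c, .b] <+: E)
    (hlen : E.length ≤ 33) (hsq : IsSquareAt t i p) (hp : 0 < p)
    (hpN : p + p ≤ 18 * n + L.length) (hi : i ≤ 18 * n - 23 + k)
    (hj : 18 * n - 23 + k + E.length ≤ i + p + p) :
    i + p ∈ Set.Ioo (18 * n - 23 + k : ℤ) (18 * n - 23 + k + E.length) :=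
  hsq.center_mem_Ioo (N := 18 * n + L.length) hp (by omega)
    (fun _ hx => ht.dvd_sub_of_factor_eq hocc hE hlen
      (hx.trans (ht.factor_eq_of_occurrences_eq hocc))) hi hj

theorem center_mem_leftMarker (ht : IsLinkedWord t V n L) (hsq : IsSquareAt t i p) (hp : 0 < p)
    (hpN : p + p ≤ 18 * n + L.length) (hi : i ≤ 18 * n) (hj : 18 * n + 10 ≤ i + p + p) :
    18 * n < i + p ∧ i + p < 18 * n + 10 := by
  have := ht.center_mem_Ioo_of_occurrences_eq ht.isLink.occurrences_leftMarker (by decide)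
    (by decide) hsq hp hpN (by omega) (by simp only [leftMarker, List.length]; omega)
  simp only [leftMarker, List.length, Set.mem_Ioo] at this
  omega

theorem center_mem_rightMarker (ht : IsLinkedWord t V n L) (hsq : IsSquareAt t i p) (hp : 0 < p)
    (hpN : p + p ≤ 18 * n + L.length) (hi : i ≤ 18 * n + L.length - 6)
    (hj : 18 * n + L.length + 3 ≤ i + p + p) :
    18 * n + L.length - 6 < i + p ∧ i + p < 18 * n + L.length + 3 := by
  have := ht.center_mem_Ioo_of_occurrences_eq ht.isLink.occurrences_rightMarker (by decide)
    (by decide) hsq hp hpN (by omega) (by simp only [rightMarker, List.length]; omega)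
  simp only [rightMarker, List.length, Set.mem_Ioo] at this
  omega

theorem exists_isSquareAt_of_le (ht : IsLinkedWord t V n L) (hsq : IsSquareAt t i p) (hp : 0 < p)
    (hi : -5 ≤ i) (hj : i + p + p ≤ 18 * n + 4) :
    ∃ m q, 0 < q ∧ q + q ≤ n ∧ IsSquareAt V m q := by
  have hblock := hsq.congr (factor_eq_factor_of_subset ht.factor_blocks_extended hi
    (by push_cast; omega))
  obtain ⟨m, q, hq, rfl, hsqV⟩ := exists_isSquareAt_of_blockWord ht.letter_ne hp hblock
  exact ⟨m, q, hq, by omega, hsqV⟩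

theorem not_isSquareAt_of_window (ht : IsLinkedWord t V n L) (hp : 0 < p)
    (hi : 18 * n - 23 ≤ i) (hj : i + p + p ≤ 18 * n + L.length + 28) : ¬ IsSquareAt t i p := by
  have hfree := ht.isLink.squareFree_window
  rw [← ht.factor_window] at hfree
  exact hfree.not_isSquareAt hp hi (by push_cast; omega)

theorem not_isSquareAt_of_end_near (ht : IsLinkedWord t V n L) (hp : 0 < p) (hi : -5 ≤ i)
    (hj : 18 * n + 5 ≤ i + p + p) (hj' : i + p + p ≤ 18 * n + 9) : ¬ IsSquareAt t i p := by
  intro hsq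
  rcases lt_or_ge p 9 with hlt | hle
  · exact ht.not_isSquareAt_of_window hp (by omega) (by omega) hsq
  · have habacb : factor t (18 * n) 5 = [.a, .b, .a, .c, .b] := by
      have := ht.factor_eq_of_occurrences_eq ht.isLink.occurrences_leftMarker
      rw [Nat.cast_ofNat, sub_add_cancel] at this
      rw [← take_factor (n := 10) (by norm_num), show 10 = leftMarker.length from rfl, this]
      rfl
    refine ht.factor_ne_abacb (x := 18 * n - p) (by omega) (by omega) ?_
    rw [hsq.factor_sub_period (by omega) (by omega), habacb]

theorem not_isSquareAt_of_leftContext (ht : IsLinkedWord t V n L) (hp : 0 < p)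
    (hpN : p + p ≤ 18 * n + L.length) (hi : i < 18 * n - 23) (hj : 18 * n + 10 ≤ i + p + p) :
    ¬ IsSquareAt t i p := by
  intro hsq
  have hleft := ht.center_mem_leftMarker hsq hp hpN (by omega) hj
  have hlen := ht.isLink.le_length
  rcases le_or_gt (18 * n + L.length + 3 : ℤ) (i + p + p) with hle | hlt
  · have := ht.center_mem_rightMarker hsq hp hpN (by omega) hle
    omega
  · refine ht.isLink.not_leftContext_isInfix ?_
    rw [← ht.factor_link_append, isInfix_factor_iff]
    have : ((p - 23 : ℕ) : ℤ) = p - 23 := by omega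
    refine ⟨p - 23, by rw [show leftContext.length = 23 from rfl]; omega, ?_⟩
    rw [show (18 * n : ℤ) + (p - 23 : ℕ) = 18 * n - 23 + p by omega,
      show leftContext.length = 23 from rfl, hsq.factor_add_period (by omega) (by omega),
      ht.factor_leftContext]

theorem not_isSquareAt_of_rightContext (ht : IsLinkedWord t V n L) (hp : 0 < p)
    (hpN : p + p ≤ 18 * n + L.length) (hi : i < 18 * n + L.length - 5)
    (hj : 18 * n + L.length + 28 < i + p + p) : ¬ IsSquareAt t i p := by
  intro hsq
  have hright := ht.center_mem_rightMarker hsq hp hpN (by omega) (by omega)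
  have hlen := ht.isLink.le_length
  rcases le_or_gt i (18 * n) with hle | hlt
  · have := ht.center_mem_leftMarker hsq hp hpN hle (by omega)
    omega
  · refine ht.isLink.not_rightContext_isInfix ?_
    rw [← ht.factor_link_append, isInfix_factor_iff]
    refine ⟨L.length + 3 - p, by rw [show (rightContext.drop 3).length = 25 from rfl]; omega, ?_⟩
    rw [show (18 * n : ℤ) + (L.length + 3 - p : ℕ) = 18 * n + L.length + 3 - p by omega,
      show (rightContext.drop 3).length = 25 from rfl,
      hsq.factor_sub_period (by omega) (by push_cast; omega), ht.factor_rightContext_drop]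

theorem exists_isSquareAt (ht : IsLinkedWord t V n L) (hsq : IsSquareAt t i p) (hp : 0 < p)
    (hpN : p + p ≤ 18 * n + L.length) : ∃ m q, 0 < q ∧ q + q ≤ n ∧ IsSquareAt V m q := by
  obtain ⟨i, k, rfl, hi, hiN⟩ := ht.exists_eq_add_mul_period i
  replace hsq : IsSquareAt t i p := hsq.congr (factor_add_mul_of_periodic ht.periodic k)
  rcases le_or_gt (i + p + p) (18 * n + 4) with hj | hj
  · exact ht.exists_isSquareAt_of_le hsq hp hi hj
  exfalso
  rcases le_or_gt (i + p + p) (18 * n + 9) with hj' | hj'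
  · exact ht.not_isSquareAt_of_end_near hp hi (by omega) hj' hsq
  rcases lt_or_ge i (18 * n - 23) with hi' | hi'
  · exact ht.not_isSquareAt_of_leftContext hp hpN hi' (by omega) hsq
  rcases le_or_gt (i + p + p) (18 * n + L.length + 28) with hj'' | hj''
  · exact ht.not_isSquareAt_of_window hp hi' hj'' hsq
  · exact ht.not_isSquareAt_of_rightContext hp hpN hiN hj'' hsq

end IsLinkedWord

/-! ### Square-freeness of the decoded circular words -/

theorem CircularSquareFree.not_isCircularFactor_pair {α : Type*} {Z : Cycle α}
    (h : CircularSquareFree Z) (x : α) : ¬ IsCircularFactor [x, x] Z :=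
  h [x] (List.cons_ne_nil _ _)

section Circular

variable {α : Type*} [Inhabited α]

theorem factor_periodicExtension_append_left (l m : List α) :
    factor (periodicExtension (l ++ m)) 0 l.length = l := by
  rw [← take_factor (n := (l ++ m).length) (by simp), factor_periodicExtension_zero,
    List.take_left]

theorem factor_periodicExtension_append_right (l m : List α) :
    factor (periodicExtension (l ++ m)) l.length m.length = m := by
  have h := factor_periodicExtension_zero (l ++ m)
  rw [List.length_append, factor_add, zero_add] at h
  exact List.append_inj_right h (by simp)

theorem periodicExtension_zero_of_isPrefix {x : α} {l : List α} (h : [x] <+: l) :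
    periodicExtension l 0 = x := by
  obtain ⟨m, rfl⟩ := h
  simpa [factor] using factor_periodicExtension_append_left [x] m

theorem periodicExtension_neg_one_of_isSuffix {x : α} {l : List α} (h : [x] <:+ l) :
    periodicExtension l (-1) = x := by
  obtain ⟨m, rfl⟩ := h
  have := factor_periodicExtension_append_right m [x]
  rw [← periodic_periodicExtension]
  simpa [factor] using this

theorem periodicExtension_ne_periodicExtension_succ {l : List α} (hl : 2 ≤ l.length)
    (h : ∀ x, ¬ IsCircularFactor [x, x] (l : Cycle α)) (m : ℤ) :
    periodicExtension l m ≠ periodicExtension l (m + 1) := fun heq =>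
  h (periodicExtension l m)
    (isCircularFactor_coe_iff.2 ⟨hl, m, by simp [factor, ← heq, List.range_succ]⟩)

end Circular

theorem length_flatMap_g (v : List A) : (v.flatMap g).length = 18 * v.length := by
  induction v with
  | nil => rfl
  | cons x v ih => rw [List.flatMap_cons, List.length_append, ih, length_g, List.length_cons]; ring

theorem isLinkedWord_periodicExtension {v L : List A} (hv : CircularSquareFree (v : Cycle A))
    (hprefix : [A.a] <+: v) (hsuffix : [A.b] <:+ v) (hL : IsLink L) :
    IsLinkedWord (periodicExtension (v.flatMap g ++ L)) (periodicExtension v) v.length L := by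
  have hzero := periodicExtension_zero_of_isPrefix hprefix
  have hneg := periodicExtension_neg_one_of_isSuffix hsuffix
  have hlen : 2 ≤ v.length := by
    by_contra! hlt
    have h1 : v.length = 1 := le_antisymm (by omega) hprefix.length_le
    have := periodic_periodicExtension v (-1)
    simp [h1, hzero, hneg] at this
  refine ⟨hL, hlen,
    periodicExtension_ne_periodicExtension_succ hlen hv.not_isCircularFactor_pair,
    hzero, hneg, periodic_periodicExtension v, ?_, ?_, ?_⟩
  · have := periodic_periodicExtension (v.flatMap g ++ L)
    rwa [List.length_append, length_flatMap_g, Nat.cast_add, Nat.cast_mul, Nat.cast_ofNat] at this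
  · have hblocks := factor_blockWord_mul (periodicExtension v) 0 v.length
    rw [mul_zero, factor_periodicExtension_zero] at hblocks
    rw [hblocks, ← length_flatMap_g, factor_periodicExtension_append_left]
  · have := factor_periodicExtension_append_right (v.flatMap g) L
    rwa [length_flatMap_g, Nat.cast_mul, Nat.cast_ofNat] at this

theorem circularSquareFree_flatMap_g_append {v L : List A}
    (hv : CircularSquareFree (v : Cycle A)) (hprefix : [A.a] <+: v) (hsuffix : [A.b] <:+ v)
    (hL : IsLink L) : CircularSquareFree ((v.flatMap g ++ L : List A) : Cycle A) := by
  refine circularSquareFree_coe_iff.2 fun i p hp hpl hsq => ?_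
  rw [List.length_append, length_flatMap_g] at hpl
  obtain ⟨m, q, hq, hqv, hsqv⟩ := (isLinkedWord_periodicExtension hv hprefix hsuffix
    hL).exists_isSquareAt hsq hp (by exact_mod_cast hpl)
  exact circularSquareFree_coe_iff.1 hv m q hq hqv hsqv

/-! ### Pansiot encodings -/

section Uniqueness

variable {t t' : ℤ → A} {U : Cycle B} {Z Z' : Cycle A}

/-- The Pansiot encoding of a two-sided infinite word. -/
def encode (t : ℤ → A) (i : ℤ) : B := if t i = t (i + 2) then 0 else 1

theorem periodicExtension_pansiotWord {z : List A} (hz : 0 < z.length) :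
    periodicExtension (pansiotWord z) = encode (periodicExtension z) := by
  have hlen : (pansiotWord z).length = z.length := List.length_ofFn
  refine (eq_periodicExtension_of_periodic (fun x => ?_) (hz.trans_eq hlen.symm) ?_).symm
  · rw [hlen, encode, encode, add_right_comm, periodic_periodicExtension,
      periodic_periodicExtension]
  · refine List.ext_getElem length_factor fun i hi _ => ?_
    rw [length_factor, hlen] at hi
    have hletter := periodicExtension_natCast (k := i) hz
    have hletter' := periodicExtension_natCast (k := i + 2) hz
    simp only [Nat.mod_eq_of_lt hi] at hletter
    push_cast at hletter'
    simp [factor, encode, pansiotWord, hletter, hletter']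

theorem exists_perm_apply_eq {x y x' y' : A} (h : x ≠ y) (h' : x' ≠ y') :
    ∃ π : Equiv.Perm A, π x = x' ∧ π y = y' := by
  decide +revert

theorem exists_perm_of_encode_eq (ht : ∀ i, t i ≠ t (i + 1)) (ht' : ∀ i, t' i ≠ t' (i + 1))
    (h : encode t = encode t') : ∃ π : Equiv.Perm A, ∀ m : ℕ, t' m = π (t m) := by
  obtain ⟨π, h0, h1⟩ := exists_perm_apply_eq (ht 0) (ht' 0)
  refine ⟨π, fun m => ?_⟩
  induction m using Nat.twoStepInduction with
  | zero => exact h0.symm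
  | one => exact h1.symm
  | more m ih ih' =>
    have eq_of_ne : ∀ {x y z z' : A}, y ≠ z → y ≠ z' → x ≠ y → (x = z ↔ x = z') → z = z' := by
      decide
    have hne' := ht' m
    have hsucc := ht (m + 1)
    have hsucc' := ht' (m + 1)
    have hm := congrFun h m
    simp only [encode] at hm
    push_cast at ih' ⊢
    rw [add_assoc] at hsucc hsucc'
    rw [ih'] at hsucc' hne'
    rw [ih] at hm hne'
    refine eq_of_ne hsucc' (π.injective.ne hsucc) hne' ?_
    rw [π.injective.eq_iff]
    split_ifs at hm <;> simp_all

theorem IsCircularPansiotEncoding.length_eq (h : IsCircularPansiotEncoding U Z) :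
    U.length = Z.length := by
  obtain ⟨-, -, z, rfl, rfl⟩ := h
  exact List.length_ofFn

theorem IsCircularPansiotEncoding.exists_perm (h : IsCircularPansiotEncoding U Z)
    (h' : IsCircularPansiotEncoding U Z') : ∃ π : Equiv.Perm A, Z' = Z.map π := by
  have hlen : Z.length = Z'.length := h.length_eq.symm.trans h'.length_eq
  obtain ⟨hl, hpair, z, rfl, rfl⟩ := h
  obtain ⟨hl', hpair', z', rfl, hU⟩ := h'
  obtain ⟨k, hk⟩ := Cycle.coe_eq_coe.1 hU
  rw [Cycle.length_coe] at hl hl' hlen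
  rw [Cycle.length_coe] at hlen
  have hencode : encode (fun i => periodicExtension z (i + k)) = encode (periodicExtension z') := by
    rw [← periodicExtension_pansiotWord (by omega), ← hk, periodicExtension_rotate,
      periodicExtension_pansiotWord (by omega)]
    funext i
    rw [encode, encode, add_right_comm]
  obtain ⟨π, hπ⟩ := exists_perm_of_encode_eq
    (fun i => by
      rw [add_right_comm]
      exact periodicExtension_ne_periodicExtension_succ hl hpair (i + k))
    (periodicExtension_ne_periodicExtension_succ hl' hpair') hencode
  refine ⟨π, ?_⟩
  have hrot : z' = (z.rotate k).map π := by
    rw [← factor_periodicExtension_zero z', ← factor_periodicExtension_natCast, ← hlen, factor,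
      factor, List.map_map]
    refine List.map_congr_left fun j _ => ?_
    simpa [add_comm] using hπ j
  rw [hrot, ← Cycle.map_coe, Cycle.coe_eq_coe.2 (List.IsRotated.symm ⟨k, rfl⟩)]

end Uniqueness

/-- The Pansiot encoding of a word that is not read circularly; it is shorter by two letters. -/
def linearPansiotWord (l : List A) : List B :=
  List.zipWith (fun x z => if x = z then 0 else 1) l (l.drop 2)

theorem getElem_append_of_isPrefix {α : Type*} {e l : List α} (h : e <+: l) {i : ℕ}
    (hi : i < (l ++ e).length) (hmod : i % l.length < l.length) :
    (l ++ e)[i] = l[i % l.length] := by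
  rcases lt_or_ge i l.length with hlt | hge
  · rw [List.getElem_append_left hlt]
    simp only [Nat.mod_eq_of_lt hlt]
  · obtain ⟨r, rfl⟩ := Nat.exists_eq_add_of_le hge
    have hr : r < e.length := by simpa using hi
    rw [List.getElem_append_right hge]
    simp only [Nat.add_mod_left, Nat.mod_eq_of_lt (hr.trans_le h.length_le), add_tsub_cancel_left]
    exact h.getElem hr

theorem pansiotWord_eq_linearPansiotWord {x y : A} {z : List A} (h : [x, y] <+: z) :
    pansiotWord z = linearPansiotWord (z ++ [x, y]) := by
  refine List.ext_getElem (by simp [pansiotWord, linearPansiotWord]) fun i hi _ => ?_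
  have hiz : i < z.length := by simpa [pansiotWord] using hi
  have hmod : (i + 2) % z.length < z.length := Nat.mod_lt _ (by omega)
  have hsucc := getElem_append_of_isPrefix h (i := i + 2) (by simpa using hiz) hmod
  simp only [pansiotWord, linearPansiotWord, List.getElem_ofFn, List.getElem_zipWith,
    List.getElem_drop, List.getElem_append_left hiz, List.get_eq_getElem, ← hsucc, add_comm 2]

theorem linearPansiotWord_append {x y : A} {m : List A} (l : List A) (h : [x, y] <+: m) :
    linearPansiotWord (l ++ m) = linearPansiotWord (l ++ [x, y]) ++ linearPansiotWord m := by
  obtain ⟨m, rfl⟩ := h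
  induction l with
  | nil => rfl
  | cons z l ih => rcases l with _ | ⟨z', _ | ⟨z'', l⟩⟩ <;> simp_all [linearPansiotWord]

theorem prefix_flatMap_g_append (v : List A) {m : List A} (h : [A.a, A.b] <+: m) :
    [A.a, A.b] <+: v.flatMap g ++ m := by
  cases v with
  | nil => exact h
  | cons x v => cases x <;> exact ⟨_, rfl⟩

theorem linearPansiotWord_flatMap_g_append (v : List A) {m : List A} (h : [A.a, A.b] <+: m) :
    linearPansiotWord (v.flatMap g ++ m) = f (LevelWords.h v) ++ linearPansiotWord m := by
  induction v with
  | nil => rfl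
  | cons x v ih =>
    have hletter : linearPansiotWord (g x ++ [A.a, A.b]) = f (hLetter x) := by
      cases x <;> rfl
    rw [List.flatMap_cons, List.append_assoc,
      linearPansiotWord_append _ (prefix_flatMap_g_append v h), hletter, ih]
    simp [f, LevelWords.h]

/-! ### The linking words -/

/-- The letter of `A` different from `x` and `y`; the value at `x = y` is irrelevant. -/
def thirdLetter : A → A → A
  | .a, .b | .b, .a => .c
  | .a, .c | .c, .a => .b
  | .b, .c | .c, .b => .a
  | x, _ => x

/-- The ternary word that starts with `x y` and has Pansiot encoding `u`, without its last two
letters. -/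
def decode : A → A → List B → List A
  | _, _, [] => []
  | x, y, u :: us => x :: decode y (if u = 0 then x else thirdLetter x y) us

/-- The ternary word inserted between `g b` and `g a` by the linking word `s`. -/
def link (s : List S) : List A := decode .a .b (f s)

theorem squareFree_window_link : ∀ {s}, s ∈ linkingWords → SquareFree (window (link s)) := by
  decide +kernel

theorem isLink_link : ∀ {s}, s ∈ linkingWords → IsLink (link s) := by
  have checks : ∀ s ∈ linkingWords, 15 ≤ (link s).length ∧
      occurrences leftMarker (window (link s)) = [23] ∧
      occurrences rightMarker (window (link s)) = [(link s).length + 17] ∧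
      ¬ leftContext <:+: link s ++ [.a, .b] ∧
      ¬ rightContext.drop 3 <:+: link s ++ [.a, .b] := by
    decide +kernel
  intro s hs
  obtain ⟨hlen, hleft, hright, hleftContext, hrightContext⟩ := checks s hs
  exact ⟨hlen, squareFree_window_link hs, hleft, hright, hleftContext, hrightContext⟩

theorem prefix_link : ∀ {s}, s ∈ linkingWords → [.a, .b] <+: link s := by
  decide +kernel

theorem linearPansiotWord_link_append :
    ∀ {s}, s ∈ linkingWords → linearPansiotWord (link s ++ [.a, .b]) = f s := by
  decide +kernel

theorem count_link_le :
    ∀ {s}, s ∈ linkingWords → ∀ x y, (link s).count y ≤ (link s).count x + 1 := by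
  decide +kernel

theorem pansiotWord_flatMap_g_append_link {s : List S} (hs : s ∈ linkingWords) (v : List A) :
    pansiotWord (v.flatMap g ++ link s) = f (h v ++ s) := by
  rw [pansiotWord_eq_linearPansiotWord (prefix_flatMap_g_append v (prefix_link hs)),
    List.append_assoc,
    linearPansiotWord_flatMap_g_append v ((prefix_link hs).trans (List.prefix_append _ _)),
    linearPansiotWord_link_append hs, f, f, f, List.flatMap_append]

theorem count_flatMap_g (v : List A) (x : A) : (v.flatMap g).count x = 6 * v.length := by
  induction v with
  | nil => rfl
  | cons y v ih =>
    have hcount : (g y).count x = 6 := by cases x <;> cases y <;> rfl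
    rw [List.flatMap_cons, List.count_append, hcount, ih, List.length_cons]
    ring

theorem isLevel_flatMap_g_append {L : List A} (hL : ∀ x y, L.count y ≤ L.count x + 1)
    (v : List A) : IsLevel ((v.flatMap g ++ L : List A) : Cycle A) := fun x y => by
  simp only [Cycle.coe_toMultiset, Multiset.coe_count, List.count_append, count_flatMap_g]
  have := hL x y
  omega

section Map

variable {α β : Type*}

theorem IsCircularFactor.map {u : List α} {Z : Cycle α} (h : IsCircularFactor u Z) (e : α → β) :
    IsCircularFactor (u.map e) (Z.map e) := by
  obtain ⟨w, rfl, hu⟩ := h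
  exact ⟨w.map e, Cycle.map_coe e w, hu.map e⟩

theorem CircularSquareFree.map {Z : Cycle α} (h : CircularSquareFree Z) (e : α ≃ β) :
    CircularSquareFree (Z.map e) := by
  intro x hx hfactor
  refine h (x.map e.symm) (by simpa using hx) ?_
  have := hfactor.map e.symm
  induction Z using Cycle.induction_on <;> simpa using this

theorem IsLevel.map {Z : Cycle A} (h : IsLevel Z) (π : Equiv.Perm A) : IsLevel (Z.map π) := by
  intro x y
  obtain ⟨x, rfl⟩ := π.surjective x
  obtain ⟨y, rfl⟩ := π.surjective y
  induction Z using Quotient.inductionOn' with | _ z => ?_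
  have hcount (w : A) : ((z : Cycle A).map π).toMultiset.count (π w) = z.count w := by
    simp [List.count_map_of_injective _ _ π.injective]
  rw [Cycle.mk''_eq_coe, hcount, hcount]
  simpa using h x y

end Map

end LevelWords

theorem mainTheorem6 (v : List LevelWords.A)
    (hv : LevelWords.CircularSquareFree (v : Cycle LevelWords.A))
    (hprefix : [LevelWords.A.a] <+: v) (hsuffix : [LevelWords.A.b] <:+ v)
    (w : List LevelWords.S) (hw : w = LevelWords.h v)
    (s : List LevelWords.S) (hs : s ∈ LevelWords.linkingWords) :
    (∃ Z : Cycle LevelWords.A,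
      LevelWords.IsCircularPansiotEncoding (LevelWords.f (w ++ s) : Cycle LevelWords.B) Z) ∧
    ∀ Z : Cycle LevelWords.A,
      LevelWords.IsCircularPansiotEncoding (LevelWords.f (w ++ s) : Cycle LevelWords.B) Z →
        LevelWords.CircularSquareFree Z ∧ LevelWords.IsLevel Z ∧
        Z.length = (LevelWords.f w).length + (LevelWords.f s).length := by
  open LevelWords in
  subst hw
  have hsf := circularSquareFree_flatMap_g_append hv hprefix hsuffix (isLink_link hs)
  have hlevel := isLevel_flatMap_g_append (count_link_le hs) v
  have henc : IsCircularPansiotEncoding (f (LevelWords.h v ++ s) : Cycle B)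
      ((v.flatMap g ++ link s : List A) : Cycle A) :=
    ⟨by simpa using (prefix_link hs).length_le.trans (Nat.le_add_left _ _),
      hsf.not_isCircularFactor_pair, _, rfl, by rw [pansiotWord_flatMap_g_append_link hs]⟩
  refine ⟨⟨_, henc⟩, fun Z hZ => ?_⟩
  obtain ⟨π, rfl⟩ := henc.exists_perm hZ
  refine ⟨hsf.map π, hlevel.map π, ?_⟩
  rw [← hZ.length_eq, Cycle.length_coe, f, List.flatMap_append, List.length_append, ← f, ← f]
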